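/- Fix a dimension $d\ge 1$. Let $B^d\subset\mathbb{R}^d$ be the closed Euclidean unit ball, $D$ the uniform distribution on $B^d$, and $H_d$ the class of all functions $h(x)=\langle w,x\rangle+b$ with $0\ne w\in\mathbb{R}^d$, $b\in\mathbb{R}$; a hypothesis $h\in H_d$ labels $x\in\mathbb{R}^d$ by $\operatorname{sgn}(h(x))\in\{+,-\}$, where $\operatorname{sgn}(0)=+$. A *Label-MQS learner making $n$ queries* is a possibly randomized algorithm that, for a hidden $h\in H_d$, adaptively makes $n$ queries, each at a point $x$ of its choice in the support $B^d$ of $D$ and answered by $\operatorname{sgn}(h(x))$, and then outputs a function $f:\mathbb{R}^d\to\{+,-,\perp\}$. It is *reliable* if, for every hidden $h\in H_d$ and every value of its randomness, $f(x)\in\{\operatorname{sgn}(h(x)),\perp\}$ for all $x\in\mathbb{R}^d$. Its *error* is $\Pr_{x\sim D}[f(x)=\perp]$. The *query complexity $q(\varepsilon,\delta)\in\mathbb{N}\cup\{\infty\}$ of Label-MQS-RPU learning $(B^d,\mathbb{R}^d,H_d)$* is the least $n$ for which there is a reliable Label-MQS learner making $n$ queries which, for every hidden $h\in H_d$, has error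 at most $\varepsilon$ with probability at least $1-\delta$ over its randomness ($q(\varepsilon,\delta)=\infty$ if there is no such $n$). **Proposition.** For all $\delta<1$, $$q(\varepsilon,\delta)=\Omega_d\!\left(\left(\frac1\varepsilon\right)^{\frac{d-1}{2}}\right),$$ that is, there are constants $c>0$ and $\varepsilon_0>0$ depending only on $d$ such that $q(\varepsilon,\delta)\ge c\,(1/\varepsilon)^{(d-1)/2}$ for all $\delta<1$ and all $0<\varepsilon<\varepsilon_0$. -/

import Mathlib

open MeasureTheory

/-- The binary label `sgn (h x)` that a real-valued hypothesis `h` gives to the point `x`: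
`true` stands for `h x ≥ 0` and `false` for `h x < 0`. -/
noncomputable def signLabel {X : Type*} (h : X → ℝ) (x : X) : Bool :=
  decide (0 ≤ h x)

/-- A randomized adaptive learner in the label-only membership query synthesis model for a
distribution `D` on the instance space `X`. All of its randomness (internal coins, and any
unlabeled sample it may draw) is the seed `ω : Ω`. Given the seed and the list of labeled queries
made so far, it synthesizes the next query, a point of the support of `D`; when it stops querying
it outputs a partial classifier, where `none` is the answer "I don't know". -/
structure LabelMQSLearner {X : Type*} [TopologicalSpace X] [MeasurableSpace X]
    (D : Measure X) (Ω : Type) where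
  query : Ω → List (X × Bool) → X
  query_mem_support : ∀ ω t, query ω t ∈ D.support
  predict : Ω → List (X × Bool) → X → Option Bool

namespace LabelMQSLearner

variable {X : Type*} [TopologicalSpace X] [MeasurableSpace X] {D : Measure X} {Ω : Type}

/-- The labeled queries (most recent first) of the first `n` rounds with seed `ω`, when the
labeling oracle answers according to the hidden hypothesis `h`. -/
noncomputable def transcript (A : LabelMQSLearner D Ω) (h : X → ℝ) (ω : Ω) : ℕ → List (X × Bool)
  | 0 => []
  | n + 1 =>
      let t := A.transcript h ω n
      (A.query ω t, signLabel h (A.query ω t)) :: t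

/-- The partial classifier output by the learner after `n` label queries. -/
noncomputable def output (A : LabelMQSLearner D Ω) (h : X → ℝ) (n : ℕ) (ω : Ω) : X → Option Bool :=
  A.predict ω (A.transcript h ω n)

/-- Reliability with `n` queries: whatever the hidden hypothesis and the seed, the output never
mislabels a point, although it may answer "I don't know". -/
def IsReliable (A : LabelMQSLearner D Ω) (H : Set (X → ℝ)) (n : ℕ) : Prop :=
  ∀ h ∈ H, ∀ (ω : Ω) (x : X) (y : Bool), A.output h n ω x = some y → y = signLabel h x

/-- The error of the output: the `D`-probability of the answer "I don't know". -/
noncomputable def error (A : LabelMQSLearner D Ω) (h : X → ℝ) (n : ℕ) (ω : Ω) : ENNReal :=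
  D {x | A.output h n ω x = none}

end LabelMQSLearner

/-- The triple `(D, X, H)` can be Label-MQS-RPU learned with `n` queries to error `ε` with
confidence `1 - δ`: there is a reliable learner that, for every hidden hypothesis of `H`, has
error at most `ε` with probability at least `1 - δ` over its seed, that is, on an event `G` of
probability at least `1 - δ`. -/
def LabelMQSRPULearnableWith {X : Type*} [TopologicalSpace X] [MeasurableSpace X]
    (D : Measure X) (H : Set (X → ℝ)) (ε δ : ℝ) (n : ℕ) : Prop :=
  ∃ (Ω : Type) (_ : MeasurableSpace Ω) (P : Measure Ω) (A : LabelMQSLearner D Ω),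
    IsProbabilityMeasure P ∧ A.IsReliable H n ∧
      ∀ h ∈ H, ∃ G : Set Ω, MeasurableSet G ∧ ENNReal.ofReal (1 - δ) ≤ P G ∧
        ∀ ω ∈ G, A.error h n ω ≤ ENNReal.ofReal ε

/-- The query complexity `q(ε, δ)` of Label-MQS-RPU learning `(D, X, H)`: the least sufficient
number of queries, and `⊤` if no finite number suffices. -/
noncomputable def labelMQSRPUQueryComplexity {X : Type*} [TopologicalSpace X] [MeasurableSpace X]
    (D : Measure X) (H : Set (X → ℝ)) (ε δ : ℝ) : ℕ∞ :=
  ⨅ (n : ℕ) (_ : LabelMQSRPULearnableWith D H ε δ n), (n : ℕ∞)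

/-- The uniform distribution on the closed unit ball `B^d` of `ℝ^d`. -/
noncomputable def uniformUnitBall (d : ℕ) : Measure (EuclideanSpace ℝ (Fin d)) :=
  ProbabilityTheory.cond volume (Metric.closedBall 0 1)

/-- The class `H_d` of (not necessarily homogeneous) hyperplanes in `ℝ^d`, as the nonconstant
affine functions `x ↦ ⟨w, x⟩ + b`. -/
def hyperplanes (d : ℕ) : Set (EuclideanSpace ℝ (Fin d) → ℝ) :=
  {h | ∃ (w : EuclideanSpace ℝ (Fin d)) (b : ℝ), w ≠ 0 ∧ ∀ x, h x = inner ℝ w x + b}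

/-! Let the hidden hypothesis be nonnegative on the whole ball, so that every answer is `+`. A point
of the ball outside the convex hull of the `n` queries can be cut off by a hyperplane giving the
same answers, so a reliable learner must abstain there (`exists_finset_convexHull_of_learnable`). It
remains to bound from below the volume that such a hull misses. Its points of norm above `1 - σ ^ 2`
lie within `2 * σ` of queries. About `1 / σ` successive shrinkings of this outer part are disjoint
and still lie within `3 * σ` of queries, so its relative volume is `O(n * σ ^ (d + 1))`. The ball
has relative volume at least `σ ^ 2` at those norms. With `ε = σ ^ 2 / 4` this forces `n` to be at
least of order `σ ^ (1 - d)`. -/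

open Metric Module Set
open scoped Pointwise

/-! ### Volume of convex hulls of few points near the sphere -/

section ConvexHull

variable {E : Type*} [NormedAddCommGroup E] [InnerProductSpace ℝ E]

/-- The part of a set in the unit ball that lies at norm larger than `1 - s`. -/
def outerShell (K : Set E) (s : ℝ) : Set E :=
  K ∩ {p | 1 - s < ‖p‖ ∧ ‖p‖ ≤ 1}

/-- Otherwise an open half-space with `p` on its boundary contains `T`, hence `p`. -/
lemma exists_norm_sq_le_inner_of_mem_convexHull {T : Set E} {p : E} (hp : p ∈ convexHull ℝ T) :
    ∃ x ∈ T, ‖p‖ ^ 2 ≤ inner ℝ p x := by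
  by_contra! h
  have hconv : Convex ℝ {y : E | inner ℝ p y < ‖p‖ ^ 2} :=
    convex_halfSpace_lt (innerₗ E p).isLinear _
  have := convexHull_min (t := {y : E | inner ℝ p y < ‖p‖ ^ 2}) (fun x hx => h x hx) hconv hp
  simp at this

/-- If `⟪p, x⟫ ≥ ‖p‖ ^ 2` and `‖x‖ ≤ 1`, then `‖p - x‖ ^ 2 ≤ 1 - ‖p‖ ^ 2 ≤ 2 * σ ^ 2`. -/
lemma norm_sub_le_of_mem_outerShell {T : Set E} (hT : T ⊆ closedBall 0 1) {p : E} {σ : ℝ}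
    (hσ : 0 ≤ σ) (hσ' : σ ≤ 1) (hp : p ∈ outerShell (convexHull ℝ T) (σ ^ 2)) :
    ∃ x ∈ T, ‖p - x‖ ≤ 2 * σ := by
  obtain ⟨hpT, hp1, -⟩ := hp
  obtain ⟨x, hx, hpx⟩ := exists_norm_sq_le_inner_of_mem_convexHull hpT
  refine ⟨x, hx, ?_⟩
  have hx1 : ‖x‖ ≤ 1 := by simpa using hT hx
  have h1 := norm_sub_sq_real p x
  have h2 : ‖x‖ ^ 2 ≤ 1 := pow_le_one₀ (norm_nonneg _) hx1
  have h3 : (1 - σ ^ 2) ^ 2 ≤ ‖p‖ ^ 2 :=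
    pow_le_pow_left₀ (by nlinarith) hp1.le 2
  refine abs_le_of_sq_le_sq' ?_ (by positivity) |>.2
  nlinarith [sq_nonneg (σ ^ 2)]

/-- The norms in the `k`-th copy lie in `((1 - s) ^ (k + 1), (1 - s) ^ k]`. -/
lemma pairwise_disjoint_smul_outerShell (K : Set E) {s : ℝ} (hs : 0 < s) (hs' : s < 1) :
    Pairwise (Function.onFun Disjoint fun k : ℕ => (1 - s) ^ k • outerShell K s) := by
  rw [pairwise_disjoint_on]
  intro i j hij
  rw [Set.disjoint_left]
  rintro _ ⟨p, hp, rfl⟩ ⟨q, hq, hqp⟩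
  have h0 : 0 < 1 - s := by linarith
  have hn := congrArg norm hqp
  simp only [norm_smul, norm_pow, Real.norm_eq_abs, abs_of_pos h0] at hn
  have h1 : (1 - s) ^ j * ‖q‖ ≤ (1 - s) ^ (i + 1) :=
    (mul_le_of_le_one_right (by positivity) hq.2.2).trans
      (pow_le_pow_of_le_one h0.le (by linarith) hij)
  have h2 : (1 - s) ^ (i + 1) < (1 - s) ^ i * ‖p‖ := by
    rw [pow_succ]
    exact mul_lt_mul_of_pos_left hp.2.1 (by positivity)
  linarith

variable [FiniteDimensional ℝ E] [MeasurableSpace E] [BorelSpace E]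
  (μ : Measure E) [μ.IsAddHaarMeasure]

/-- A convex hull of few points of the unit ball has a small part near the unit sphere. -/
lemma measureReal_outerShell_convexHull_le (T : Finset E) (hT : (T : Set E) ⊆ closedBall 0 1)
    {σ : ℝ} (hσ : 0 < σ) (hσ' : σ ≤ 1 / 2) :
    μ.real (outerShell (convexHull ℝ (T : Set E)) (σ ^ 2)) ≤
      2 * σ * (T.card * (6 * σ) ^ finrank ℝ E * μ.real (closedBall 0 1)) := by
  set S := outerShell (convexHull ℝ (T : Set E)) (σ ^ 2) with hS
  set M := ⌊1 / σ⌋₊ with hM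
  have hs0 : 0 < σ ^ 2 := by positivity
  have hs1 : σ ^ 2 < 1 := by nlinarith
  have hSm : MeasurableSet S :=
    (T.finite_toSet.isCompact_convexHull (𝕜 := ℝ)).measurableSet.inter
      ((measurableSet_lt measurable_const measurable_norm).inter
        (measurableSet_le measurable_norm measurable_const))
  have hMσ : M * σ ≤ 1 := by
    have := Nat.floor_le (one_div_pos.2 hσ).le
    rwa [le_div_iff₀ hσ] at this
  have hMσ' : 1 ≤ 2 * σ * M := by
    have := Nat.lt_floor_add_one (1 / σ)
    rw [div_lt_iff₀ hσ] at this
    nlinarith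
  -- By Bernoulli's inequality, as `k * σ ≤ 1`. So each shrinking moves points of the ball by at
  -- most `σ` and has ratio at least `1 / 2`.
  have hlam : ∀ k < M, 1 - σ ≤ (1 - σ ^ 2) ^ k := by
    intro k hk
    have h1 := one_add_mul_le_pow (a := -σ ^ 2) (by linarith) k
    have h2 : (k : ℝ) ≤ M := by exact_mod_cast hk.le
    have h3 : k * σ ≤ 1 := by nlinarith
    rw [← sub_eq_add_neg 1 (σ ^ 2)] at h1
    nlinarith
  have hsub : (⋃ k ∈ Finset.range M, (1 - σ ^ 2) ^ k • S) ⊆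
      ⋃ x ∈ T, closedBall x (3 * σ) := by
    simp only [iUnion_subset_iff, Finset.mem_range]
    rintro k hk _ ⟨p, hp, rfl⟩
    obtain ⟨x, hx, hpx⟩ := norm_sub_le_of_mem_outerShell hT hσ.le (by linarith) hp
    refine mem_biUnion hx ?_
    rw [mem_closedBall, dist_eq_norm]
    have hle : (1 - σ ^ 2) ^ k ≤ 1 := pow_le_one₀ (by linarith) (by linarith)
    have hkp : ‖(1 - (1 - σ ^ 2) ^ k) • p‖ ≤ σ := by
      rw [norm_smul, Real.norm_eq_abs, abs_of_nonneg (by linarith)]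
      have := hlam k hk
      exact (mul_le_of_le_one_right (by linarith) hp.2.2).trans (by linarith)
    have heq : (1 - σ ^ 2) ^ k • p - x = (p - x) - (1 - (1 - σ ^ 2) ^ k) • p := by module
    calc ‖(1 - σ ^ 2) ^ k • p - x‖ ≤ ‖p - x‖ + ‖(1 - (1 - σ ^ 2) ^ k) • p‖ := by
          rw [heq]; exact norm_sub_le _ _
      _ ≤ 3 * σ := by linarith
  have hfinU : μ (⋃ x ∈ T, closedBall x (3 * σ)) ≠ ⊤ :=
    (T.finite_toSet.isCompact_biUnion fun x _ => isCompact_closedBall x (3 * σ)).measure_ne_top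
  have hSfin : μ S ≠ ⊤ := ne_top_of_le_ne_top
    (isCompact_closedBall (0 : E) 1).measure_ne_top
    (measure_mono fun p hp => by simpa using hp.2.2)
  have hreal : ∀ k, μ.real ((1 - σ ^ 2) ^ k • S) =
      ((1 - σ ^ 2) ^ k) ^ finrank ℝ E * μ.real S := by
    intro k
    have h0 : (0 : ℝ) ≤ (1 - σ ^ 2) ^ k := pow_nonneg (by linarith) k
    rw [measureReal_def, Measure.addHaar_smul_of_nonneg μ h0, ENNReal.toReal_mul,
      ENNReal.toReal_ofReal (by positivity), measureReal_def]
  have hunion : μ.real (⋃ k ∈ Finset.range M, (1 - σ ^ 2) ^ k • S) =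
      ∑ k ∈ Finset.range M, ((1 - σ ^ 2) ^ k) ^ finrank ℝ E * μ.real S := by
    rw [measureReal_biUnion_finset
      (fun i _ j _ hij => pairwise_disjoint_smul_outerShell _ hs0 hs1 hij)
      (fun k _ => hSm.const_smul_of_ne_zero (pow_ne_zero k (by linarith)))
      (fun k _ => by
        rw [Measure.addHaar_smul]
        exact ENNReal.mul_ne_top ENNReal.ofReal_ne_top hSfin)]
    exact Finset.sum_congr rfl fun k _ => hreal k
  have hlow : M * ((1 / 2) ^ finrank ℝ E * μ.real S) ≤
      μ.real (⋃ k ∈ Finset.range M, (1 - σ ^ 2) ^ k • S) := by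
    rw [hunion, ← nsmul_eq_mul]
    nth_rewrite 1 [← Finset.card_range M]
    refine Finset.card_nsmul_le_sum _ _ _ fun k hk => ?_
    have := hlam k (Finset.mem_range.1 hk)
    gcongr
    linarith
  have hup : μ.real (⋃ x ∈ T, closedBall x (3 * σ)) ≤
      T.card * ((3 * σ) ^ finrank ℝ E * μ.real (closedBall 0 1)) := by
    refine (measureReal_biUnion_finset_le _ _).trans ?_
    rw [← nsmul_eq_mul]
    refine Finset.sum_le_card_nsmul _ _ _ fun x _ => ?_
    rw [Measure.addHaar_real_closedBall' μ x (by positivity)]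
  have hmain := (hlow.trans (measureReal_mono hsub hfinU)).trans hup
  have h6 : (6 * σ) ^ finrank ℝ E = 2 ^ finrank ℝ E * (3 * σ) ^ finrank ℝ E := by
    rw [← mul_pow]; ring
  have h2 : (2 : ℝ) ^ finrank ℝ E * (1 / 2) ^ finrank ℝ E = 1 := by
    rw [← mul_pow]; norm_num
  calc μ.real S ≤ 2 * σ * M * μ.real S := le_mul_of_one_le_left measureReal_nonneg hMσ'
    _ = 2 * σ * 2 ^ finrank ℝ E * (M * ((1 / 2) ^ finrank ℝ E * μ.real S)) := by
      linear_combination (-(2 * σ * M * μ.real S)) * h2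
    _ ≤ 2 * σ * 2 ^ finrank ℝ E *
        (T.card * ((3 * σ) ^ finrank ℝ E * μ.real (closedBall 0 1))) := by gcongr
    _ = _ := by rw [h6]; ring

/-- The unit ball is poorly approximated by the convex hull of few of its points. -/
lemma le_measureReal_closedBall_diff_convexHull (hE : 1 ≤ finrank ℝ E) (T : Finset E)
    (hT : (T : Set E) ⊆ closedBall 0 1) {σ : ℝ} (hσ : 0 < σ) (hσ' : σ ≤ 1 / 2) :
    (σ ^ 2 - 2 * σ * (T.card * (6 * σ) ^ finrank ℝ E)) * μ.real (closedBall 0 1) ≤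
      μ.real (closedBall 0 1 \ convexHull ℝ (T : Set E)) := by
  have hs0 : 0 < σ ^ 2 := by positivity
  have hs1 : σ ^ 2 < 1 := by nlinarith
  have hfin : ∀ r, μ (closedBall (0 : E) r) ≠ ⊤ := fun r =>
    (isCompact_closedBall (0 : E) r).measure_ne_top
  have hcover : closedBall (0 : E) 1 ⊆
      (closedBall 0 (1 - σ ^ 2) ∪ outerShell (convexHull ℝ (T : Set E)) (σ ^ 2)) ∪
        closedBall 0 1 \ convexHull ℝ (T : Set E) := by
    intro p hp
    by_cases hpK : p ∈ convexHull ℝ (T : Set E)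
    · left
      rcases le_or_gt ‖p‖ (1 - σ ^ 2) with h | h
      · left; simpa using h
      · right; exact ⟨hpK, h, by simpa using hp⟩
    · right; exact ⟨hp, hpK⟩
  have hshell := measureReal_outerShell_convexHull_le μ T hT hσ hσ'
  have hball : μ.real (closedBall (0 : E) (1 - σ ^ 2)) ≤
      (1 - σ ^ 2) * μ.real (closedBall (0 : E) 1) := by
    rw [Measure.addHaar_real_closedBall' μ 0 (by linarith)]
    gcongr
    -- Positive dimension is needed here.
    exact pow_le_of_le_one (by linarith) (by linarith) (by omega)
  have h := measureReal_mono (μ := μ) hcover (by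
    refine ne_top_of_le_ne_top (hfin 1) (measure_mono ?_)
    refine union_subset (union_subset (closedBall_subset_closedBall (by linarith)) ?_) sdiff_subset
    exact fun p hp => by simpa using hp.2.2)
  have h1 := measureReal_union_le (μ := μ)
    (closedBall (0 : E) (1 - σ ^ 2) ∪ outerShell (convexHull ℝ (T : Set E)) (σ ^ 2))
    (closedBall 0 1 \ convexHull ℝ (T : Set E))
  have h2 := measureReal_union_le (μ := μ)
    (closedBall (0 : E) (1 - σ ^ 2)) (outerShell (convexHull ℝ (T : Set E)) (σ ^ 2))
  linarith

end ConvexHull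

/-! ### Indistinguishable hypotheses -/

namespace LabelMQSLearner

variable {X : Type*} [TopologicalSpace X] [MeasurableSpace X] {D : Measure X} {Ω : Type}

lemma length_transcript (A : LabelMQSLearner D Ω) (h : X → ℝ) (ω : Ω) (n : ℕ) :
    (A.transcript h ω n).length = n := by
  induction n with
  | zero => rfl
  | succ n ih => simp [transcript, ih]

lemma mem_support_of_mem_transcript (A : LabelMQSLearner D Ω) (h : X → ℝ) (ω : Ω) {n : ℕ}
    {z : X × Bool} (hz : z ∈ A.transcript h ω n) : z.1 ∈ D.support := by
  induction n with
  | zero => simp [transcript] at hz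
  | succ n ih =>
    rcases List.mem_cons.1 hz with rfl | hz
    · exact A.query_mem_support _ _
    · exact ih hz

/-- For a fixed seed each query is determined by the earlier answers, so agreement along one
transcript suffices. -/
lemma transcript_eq_of_forall_signLabel_eq (A : LabelMQSLearner D Ω) {h h' : X → ℝ} (ω : Ω) {n : ℕ}
    (hh : ∀ z ∈ A.transcript h ω n, signLabel h' z.1 = signLabel h z.1) :
    A.transcript h' ω n = A.transcript h ω n := by
  induction n with
  | zero => rfl
  | succ n ih =>
    have ih' := ih fun z hz => hh z (List.mem_cons_of_mem _ hz)
    have hq := hh _ List.mem_cons_self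
    simp only [transcript, ih']
    rw [hq]

/-- A reliable learner abstains wherever two hypotheses that agree on its queries differ. -/
lemma IsReliable.output_eq_none {A : LabelMQSLearner D Ω} {H : Set (X → ℝ)} {n : ℕ}
    (hA : A.IsReliable H n) {h h' : X → ℝ} (hh : h ∈ H) (hh' : h' ∈ H) (ω : Ω)
    (hagree : ∀ z ∈ A.transcript h ω n, signLabel h' z.1 = signLabel h z.1) {x : X}
    (hx : signLabel h x ≠ signLabel h' x) : A.output h n ω x = none := by
  have hout : A.output h' n ω = A.output h n ω := by
    simp only [output, A.transcript_eq_of_forall_signLabel_eq ω hagree]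
  rcases hy : A.output h n ω x with _ | y
  · rfl
  · exact absurd ((hA h hh ω x y hy).symm.trans (hA h' hh' ω x y (by rw [hout, hy]))) hx

end LabelMQSLearner

/-! ### From learners to convex hulls -/

lemma exists_mem_hyperplanes_separating {d : ℕ} (hd : 1 ≤ d)
    (T : Finset (EuclideanSpace ℝ (Fin d))) {x : EuclideanSpace ℝ (Fin d)}
    (hx : x ∉ convexHull ℝ (T : Set (EuclideanSpace ℝ (Fin d)))) :
    ∃ h ∈ hyperplanes d, h x < 0 ∧ ∀ y ∈ T, 0 ≤ h y := by
  have : Nonempty (Fin d) := ⟨⟨0, hd⟩⟩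
  rcases T.eq_empty_or_nonempty with rfl | ⟨y₀, hy₀⟩
  · obtain ⟨w, hw⟩ := exists_ne (0 : EuclideanSpace ℝ (Fin d))
    exact ⟨fun y => inner ℝ w y + (-inner ℝ w x - 1), ⟨w, _, hw, fun _ => rfl⟩,
      by linarith, by simp⟩
  · obtain ⟨f, u, hfx, hfu⟩ := geometric_hahn_banach_point_closed (convex_convexHull ℝ _)
      (T.finite_toSet.isCompact_convexHull (𝕜 := ℝ)).isClosed hx
    have hinner : ∀ y, inner ℝ ((InnerProductSpace.toDual ℝ _).symm f) y = f y := fun y =>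
      InnerProductSpace.toDual_symm_apply
    have hfT : ∀ y ∈ T, u < f y := fun y hy => hfu y (subset_convexHull ℝ _ hy)
    refine ⟨fun y => f y - u, ⟨(InnerProductSpace.toDual ℝ _).symm f, -u, ?_, ?_⟩, ?_, ?_⟩
    -- A zero normal would give `f x = f y₀`, against strict separation; this is why empty `T` is
    -- treated apart.
    · intro h0
      have h1 := hinner x
      have h2 := hinner y₀
      rw [h0, inner_zero_left] at h1 h2
      linarith [hfT y₀ hy₀]
    · intro y; rw [hinner]; ring
    · simpa using hfx
    · intro y hy; simpa using (hfT y hy).le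

lemma support_uniformUnitBall_subset (d : ℕ) :
    (uniformUnitBall d).support ⊆ closedBall 0 1 :=
  Measure.support_subset_of_isClosed isClosed_closedBall
    (ProbabilityTheory.ae_cond_mem measurableSet_closedBall)

/-- A learner that meets the error bound for a hypothesis that is nonnegative on the unit ball
queries points of the ball whose convex hull has almost full volume. -/
lemma exists_finset_convexHull_of_learnable {d : ℕ} (hd : 1 ≤ d) {ε δ : ℝ} (hδ : δ < 1) {n : ℕ}
    (hn : LabelMQSRPULearnableWith (uniformUnitBall d) (hyperplanes d) ε δ n) :
    ∃ T : Finset (EuclideanSpace ℝ (Fin d)), T.card ≤ n ∧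
      (T : Set (EuclideanSpace ℝ (Fin d))) ⊆ closedBall 0 1 ∧
      uniformUnitBall d (closedBall 0 1 \ convexHull ℝ (T : Set (EuclideanSpace ℝ (Fin d)))) ≤
        ENNReal.ofReal ε := by
  classical
  obtain ⟨Ω, _, P, A, hP, hA, hgood⟩ := hn
  set e : EuclideanSpace ℝ (Fin d) := EuclideanSpace.single ⟨0, hd⟩ 1 with he
  have he1 : ‖e‖ = 1 := by simp [he]
  set h : EuclideanSpace ℝ (Fin d) → ℝ := fun x => inner ℝ e x + 1 with hh
  have hmem : h ∈ hyperplanes d := ⟨e, 1, by rw [← norm_ne_zero_iff, he1]; simp, fun _ => rfl⟩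
  have hpos : ∀ x ∈ closedBall (0 : EuclideanSpace ℝ (Fin d)) 1, 0 ≤ h x := by
    intro x hx
    have h1 := (abs_le.1 (abs_real_inner_le_norm e x)).1
    have h2 : ‖x‖ ≤ 1 := by simpa using hx
    rw [he1, one_mul] at h1
    simp only [hh]
    linarith
  obtain ⟨G, -, hPG, herr⟩ := hgood h hmem
  -- Since `δ < 1`, there is a good seed, and one is enough.
  obtain ⟨ω, hω⟩ : G.Nonempty := by
    refine nonempty_of_measure_ne_zero (μ := P) (ne_of_gt (lt_of_lt_of_le ?_ hPG))
    exact ENNReal.ofReal_pos.2 (by linarith)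
  set T := ((A.transcript h ω n).map Prod.fst).toFinset with hT
  have hTball : (T : Set (EuclideanSpace ℝ (Fin d))) ⊆ closedBall 0 1 := by
    intro x hx
    simp only [hT, Finset.mem_coe, List.mem_toFinset, List.mem_map] at hx
    obtain ⟨z, hz, rfl⟩ := hx
    exact support_uniformUnitBall_subset d (A.mem_support_of_mem_transcript h ω hz)
  refine ⟨T, ?_, hTball, ?_⟩
  · refine (List.toFinset_card_le _).trans ?_
    rw [List.length_map, A.length_transcript]
  · refine (measure_mono fun x hx => ?_).trans (herr ω hω)
    obtain ⟨h', hh', hx', hT'⟩ := exists_mem_hyperplanes_separating hd T hx.2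
    refine hA.output_eq_none hmem hh' ω (fun z hz => ?_) ?_
    · have hzT : z.1 ∈ T := by
        simp only [hT, List.mem_toFinset]
        exact List.mem_map_of_mem hz
      simp [signLabel, hT' _ hzT, hpos _ (hTball hzT)]
    · simp [signLabel, hpos x hx.1, hx']

lemma lt_card_mul_of_learnable {m : ℕ} {σ δ : ℝ} (hδ : δ < 1) (hσ : 0 < σ)
    (hσ' : σ ≤ 1 / 2) {n : ℕ}
    (hn : LabelMQSRPULearnableWith (uniformUnitBall (m + 1)) (hyperplanes (m + 1))
      (σ ^ 2 / 4) δ n) :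
    1 < 4 * 6 ^ (m + 1) * σ ^ m * n := by
  obtain ⟨T, hTn, hTball, hTε⟩ := exists_finset_convexHull_of_learnable (by omega) hδ hn
  set K := convexHull ℝ (T : Set (EuclideanSpace ℝ (Fin (m + 1)))) with hK
  set B := closedBall (0 : EuclideanSpace ℝ (Fin (m + 1))) 1 with hB
  have hB0 : volume B ≠ 0 := (measure_closedBall_pos volume _ one_pos).ne'
  have hBtop : volume B ≠ ⊤ := (isCompact_closedBall _ _).measure_ne_top
  have hBpos : 0 < volume.real B := ENNReal.toReal_pos hB0 hBtop
  have hgeom := le_measureReal_closedBall_diff_convexHull volume (by simp) T hTball hσ hσ'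
  rw [finrank_euclideanSpace_fin, ← hK, ← hB] at hgeom
  have hvol : volume.real (B \ K) ≤ σ ^ 2 / 4 * volume.real B := by
    rw [uniformUnitBall, ProbabilityTheory.cond_apply measurableSet_closedBall, ← hB,
      inter_eq_self_of_subset_right sdiff_subset, mul_comm, ← div_eq_mul_inv,
      ENNReal.div_le_iff hB0 hBtop] at hTε
    have := ENNReal.toReal_mono (ENNReal.mul_ne_top ENNReal.ofReal_ne_top hBtop) hTε
    rwa [ENNReal.toReal_mul, ENNReal.toReal_ofReal (by positivity)] at this
  have h1 := le_of_mul_le_mul_right (hgeom.trans hvol) hBpos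
  have hTn' : (T.card : ℝ) ≤ n := by exact_mod_cast hTn
  have h2 : 2 * σ * (T.card * (6 * σ) ^ (m + 1)) ≤ 2 * σ * (n * (6 * σ) ^ (m + 1)) := by gcongr
  have h3 : 2 * σ * (n * (6 * σ) ^ (m + 1)) = σ ^ 2 * (2 * 6 ^ (m + 1) * σ ^ m * n) := by
    rw [mul_pow]; ring
  have hs : 0 < σ ^ 2 := by positivity
  have h4 : σ ^ 2 * (3 / 4) ≤ σ ^ 2 * (2 * 6 ^ (m + 1) * σ ^ m * n) := by linarith
  have h5 := le_of_mul_le_mul_left h4 hs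
  linarith

theorem mainTheorem6 (d : ℕ) (hd : 1 ≤ d) :
    ∃ c > (0 : ℝ), ∃ ε₀ > (0 : ℝ), ∀ δ : ℝ, δ < 1 → ∀ ε : ℝ, 0 < ε → ε < ε₀ →
      ENNReal.ofReal (c * (1 / ε) ^ (((d : ℝ) - 1) / 2)) ≤
        (labelMQSRPUQueryComplexity (uniformUnitBall d) (hyperplanes d) ε δ : ENNReal) := by
  obtain ⟨m, rfl⟩ : ∃ m, d = m + 1 := ⟨d - 1, by omega⟩
  refine ⟨1 / (4 * 6 ^ (m + 1) * 2 ^ m), by positivity, 1 / 16, by norm_num, ?_⟩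
  intro δ hδ ε hε hε₀
  have hsq : 0 < √ε := Real.sqrt_pos.2 hε
  have hsq2 : √ε ^ 2 = ε := Real.sq_sqrt hε.le
  have hsq4 : √ε ≤ 1 / 4 := Real.sqrt_le_iff.2 ⟨by norm_num, by linarith⟩
  have hpow : (1 / ε) ^ ((((m + 1 : ℕ) : ℝ) - 1) / 2) = 1 / √ε ^ m := by
    rw [Nat.cast_add_one, add_sub_cancel_right, div_eq_mul_one_div (m : ℝ) 2, mul_comm,
      Real.rpow_mul (by positivity), ← Real.sqrt_eq_rpow, Real.rpow_natCast,
      Real.sqrt_div zero_le_one, Real.sqrt_one, div_pow, one_pow]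
  set r := 1 / (4 * 6 ^ (m + 1) * 2 ^ m) * (1 / ε) ^ ((((m + 1 : ℕ) : ℝ) - 1) / 2) with hr
  have hnat : ((⌈r⌉₊ : ℕ) : ℕ∞) ≤
      labelMQSRPUQueryComplexity (uniformUnitBall (m + 1)) (hyperplanes (m + 1)) ε δ := by
    refine le_iInf₂ fun n hn => ?_
    rw [Nat.cast_le, Nat.ceil_le]
    -- Take `σ = 2 * √ε`, at most `1 / 2` because `ε < 1 / 16`; it yields the factor `2 ^ m` in the
    -- constant.
    have heq : ε = (2 * √ε) ^ 2 / 4 := by rw [mul_pow, hsq2]; ring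
    rw [heq] at hn
    have := lt_card_mul_of_learnable hδ (by positivity) (by linarith) hn
    rw [hr, hpow, div_mul_div_comm, one_mul, div_le_iff₀ (by positivity)]
    rw [mul_pow] at this
    linarith
  calc ENNReal.ofReal r ≤ ENNReal.ofReal (⌈r⌉₊ : ℝ) := ENNReal.ofReal_le_ofReal (Nat.le_ceil r)
    _ = (((⌈r⌉₊ : ℕ) : ℕ∞) : ENNReal) := by simp
    _ ≤ _ := ENat.toENNReal_le.2 hnat
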